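/- All matroids and directed graphs are finite. A matroid $M$ is called strongly base reorderable if for any two bases $A,B$ of $M$ there exist bases $A',B'$ of $M$ with $A'\cap B'=A\cap B$ and $A'\cup B'=A\cup B$, and a bijection $\varphi\colon A'\setminus B'\to B'\setminus A'$, such that $(A'\setminus X)\cup\varphi(X)$ is a basis of $M$ for every $X\subseteq A'\setminus B'$. Theorem. The class of strongly base reorderable matroids is complete in Ingleton's sense, that is, it is closed under isomorphism and under the following operations: 1. taking minors; 2. taking duals; 3. taking direct sums; 4. truncation: for $k\ge 0$, the truncation of $M$ to rank at most $k$ is the matroid on the ground set of $M$ whose independent sets are the independent sets of $M$ with at most $k$ elements; 5. induction by directed graphs: let $D$ be a directed graph with vertex set $V$, let $M$ be a matroid whose ground set is contained in $V$, and let $W\subseteq V$. The sets $X\subseteq W$ that are linked in $D$ to some independent set $I$ of $M$ are the independent sets of a matroid on $W$, the matroid induced from $M$ by $D$, and if $M$ is strongly base reorderable then so is this induced matroid. Here $X$ is linked to $I$ if there are a bijection $e\colon X\to I$ and pairwise vertex-disjoint directed paths in $D$, one from $x$ to $e(x)$ for each $x\in X$, where a path may consist of a single vertex. -/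

import Mathlib

universe u

namespace SBRO

/-- A matroid `M` is strongly base reorderable if for any two bases `A, B` there are bases
`A', B'` with `A' ∩ B' = A ∩ B` and `A' ∪ B' = A ∪ B`, and a bijection
`φ : A' \ B' → B' \ A'`, such that `(A' \ X) ∪ φ(X)` is a basis for all `X ⊆ A' \ B'`. -/
def IsStronglyBaseReorderable {α : Type*} (M : Matroid α) : Prop :=
  ∀ A B : Set α, M.IsBase A → M.IsBase B →
    ∃ A' B' : Set α, M.IsBase A' ∧ M.IsBase B' ∧ A' ∩ B' = A ∩ B ∧ A' ∪ B' = A ∪ B ∧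
      ∃ φ : α → α, Set.BijOn φ (A' \ B') (B' \ A') ∧
        ∀ X ⊆ A' \ B', M.IsBase ((A' \ X) ∪ φ '' X)

/-- The truncation of a finite matroid `M` to rank (at most) `k`: its independent sets are the
independent sets of `M` with at most `k` elements. -/
def truncation {α : Type*} (M : Matroid α) [M.Finite] (k : ℕ) : Matroid α :=
  (IndepMatroid.ofFinite (E := M.E) M.ground_finite
    (fun I ↦ M.Indep I ∧ I.ncard ≤ k)
    ⟨M.empty_indep, by simp⟩
    (fun _ _ hJ hIJ ↦ ⟨hJ.1.subset hIJ,
      (Set.ncard_le_ncard hIJ (M.ground_finite.subset hJ.1.subset_ground)).trans hJ.2⟩)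
    (fun I J hI hJ hIJ ↦ by
      have hIfin := M.ground_finite.subset hI.1.subset_ground
      have hJfin := M.ground_finite.subset hJ.1.subset_ground
      obtain ⟨e, he, hins⟩ := hI.1.augment hJ.1 (by
        rwa [← hIfin.cast_ncard_eq, ← hJfin.cast_ncard_eq, Nat.cast_lt])
      refine ⟨e, he.1, he.2, hins, ?_⟩
      rw [Set.ncard_insert_of_notMem he.2 hIfin]
      exact (Nat.succ_le_of_lt hIJ).trans hJ.2)
    (fun _ hI ↦ hI.1.subset_ground)).matroid

/-- `p` is the vertex sequence of a directed path of `D` from `x` to `y`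
(a single vertex is a path from itself to itself). -/
def IsDirectedPath {V : Type*} (D : Digraph V) (p : List V) (x y : V) : Prop :=
  p.Nodup ∧ p.IsChain D.Adj ∧ p.head? = some x ∧ p.getLast? = some y

/-- `X` is linked to `Y` in `D`: for some bijection `e : X ≃ Y` there is a family of
pairwise vertex-disjoint directed paths, one from each `x ∈ X` to `e x`. -/
def IsLinked {V : Type*} (D : Digraph V) (X Y : Set V) : Prop :=
  ∃ (e : X ≃ Y) (P : X → List V),
    (∀ x, IsDirectedPath D (P x) x (e x)) ∧
      Pairwise fun x x' ↦ (P x).Disjoint (P x')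

/-- `N` is the matroid on the vertex set `W` induced from the matroid `M` by the directed
graph `D`: its independent sets are the subsets of `W` that are linked in `D` to an independent
set of `M`. For given `M`, `D` and `W` there is at most one such `N`, since a matroid is
determined by its ground set and its independent sets. -/
def IsInducedBy {V : Type*} (N M : Matroid V) (D : Digraph V) (W : Set V) : Prop :=
  N.E = W ∧ ∀ X : Set V, N.Indep X ↔ X ⊆ W ∧ ∃ I, M.Indep I ∧ IsLinked D X I

/-- A class `C` of finite matroids (given as a predicate) is complete if it is closed under
isomorphism, minors, duals, direct sums, truncations, and induction by (finite) directed
graphs. -/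
structure IsCompleteClass (C : ∀ α : Type u, Matroid α → Prop) : Prop where
  /-- `M.map f hf` runs over the isomorphic copies of `M`. -/
  isomorphism : ∀ (α β : Type u) (M : Matroid α) [M.Finite] (f : α → β)
    (hf : Set.InjOn f M.E), C α M → C β (M.map f hf)
  minor : ∀ (α : Type u) (M N : Matroid α) [M.Finite], Matroid.IsMinor N M → C α M → C α N
  dual : ∀ (α : Type u) (M : Matroid α) [M.Finite], C α M → C α (Matroid.dual M)
  directSum : ∀ (α β : Type u) (M : Matroid α) (N : Matroid β) [M.Finite] [N.Finite],
    C α M → C β N → C (α ⊕ β) (Matroid.sum M N)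
  truncation : ∀ (α : Type u) (M : Matroid α) [M.Finite] (k : ℕ),
    C α M → C α (SBRO.truncation M k)
  /-- The induced matroid exists and belongs to the class. -/
  induction : ∀ (V : Type u) [Finite V] (M : Matroid V) (D : Digraph V) (W : Set V),
    C V M → ∃ N : Matroid V, IsInducedBy N M D W ∧ C V N

end SBRO

namespace SBRO

/-! Strong base reorderability is recast symmetrically: the symmetric difference of two bases splits
into pairs, and every choice of one element per pair, joined with the intersection, is independent
(`Exchangeable`). By downward induction on size this passes from bases to all pairs of equicardinal
independent sets (`isStronglyBaseReorderable_iff`), a form in which restriction and truncation are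
immediate. Duality holds because the complement of a transversal is a transversal, and minors
follow.

Two further closures carry the induction by digraphs: preimages under a map (`comap`, parallel
copies and loops) and images (`of_isImage`). For images, join each element of the symmetric
difference to its partner and to the other element of its fibre; the resulting paths pair up the
values attained once. Matching along a relation is then a preimage on edges, a restriction and an
image (`exists_matching`).

A set is linked into `Y` exactly when `Yᶜ` injects into its complement along loops and edges. Hence
induction by a digraph is matching conjugated by duality, followed by restriction to `W`. -/

variable {α β V : Type*}

/-! ### Pairings, transversals and the symmetric form of the exchange property -/

/-- `σ` partitions `S` into pairs `{x, σ x}`. -/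
structure IsPairing (σ : α → α) (S : Set α) : Prop where
  mapsTo : ∀ x ∈ S, σ x ∈ S
  invol : ∀ x ∈ S, σ (σ x) = x
  ne : ∀ x ∈ S, σ x ≠ x

/-- `T` contains exactly one element of each pair `{x, σ x}` in `S`. -/
def IsTransversal (σ : α → α) (S T : Set α) : Prop :=
  T ⊆ S ∧ ∀ x ∈ S, (x ∈ T ↔ σ x ∉ T)

/-- The symmetric difference of `A` and `B` can be partitioned into pairs so that each
transversal of the pairs forms, together with `A ∩ B`, an independent set. -/
def Exchangeable (M : Matroid α) (A B : Set α) : Prop :=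
  ∃ σ : α → α, IsPairing σ (symmDiff A B) ∧
    ∀ T, IsTransversal σ (symmDiff A B) T → M.Indep (T ∪ (A ∩ B))

theorem IsPairing.exists_transversal {σ : α → α} {S : Set α} (h : IsPairing σ S) :
    ∃ T, IsTransversal σ S T := by
  -- Any linear order serves: the smaller element of each pair is chosen.
  obtain ⟨_, -⟩ := exists_wellFoundedLT α
  refine ⟨{x ∈ S | x < σ x}, fun x hx ↦ hx.1, fun x hx ↦ ?_⟩
  have h1 := h.mapsTo x hx
  have h2 := h.invol x hx
  have h3 := h.ne x hx
  simp only [Set.mem_ofPred_eq, hx, h1, h2, true_and, not_lt]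
  exact ⟨le_of_lt, fun h ↦ lt_of_le_of_ne h h3.symm⟩

theorem IsTransversal.compl {σ : α → α} {S T : Set α} (h : IsPairing σ S)
    (hT : IsTransversal σ S T) : IsTransversal σ S (S \ T) := by
  refine ⟨Set.sdiff_subset, fun x hx ↦ ?_⟩
  have h1 := h.mapsTo x hx
  have h2 := hT.2 x hx
  simp only [Set.mem_sdiff, hx, h1, true_and, not_not]
  tauto

/-- `σ` swaps `T` with its complement in the symmetric difference, so `T` has half the size of the
latter, which is `(A \ B).ncard`. -/
theorem IsTransversal.ncard_union {σ : α → α} {A B T : Set α}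
    (h : IsPairing σ (symmDiff A B)) (hA : A.Finite) (hB : B.Finite)
    (hAB : A.ncard = B.ncard) (hT : IsTransversal σ (symmDiff A B) T) :
    (T ∪ (A ∩ B)).ncard = A.ncard := by
  have hS : (symmDiff A B).Finite := hA.symmDiff hB
  have hTfin := hS.subset hT.1
  have hI : (A ∩ B).Finite := hA.subset Set.inter_subset_left
  have h1 : T.ncard = (symmDiff A B \ T).ncard := by
    refine Set.ncard_congr (fun x _ ↦ σ x) (fun x hx ↦ ?_) (fun x y hx hy hxy ↦ ?_)
      (fun y hy ↦ ?_)
    · exact ⟨h.mapsTo x (hT.1 hx), (hT.2 x (hT.1 hx)).1 hx⟩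
    · rw [← h.invol x (hT.1 hx), ← h.invol y (hT.1 hy)]
      exact congrArg σ hxy
    · refine ⟨σ y, ?_, h.invol y hy.1⟩
      by_contra h'
      exact hy.2 ((hT.2 y hy.1).2 h')
  have h2 : (symmDiff A B \ T).ncard + T.ncard = (symmDiff A B).ncard :=
    Set.ncard_sdiff_add_ncard_of_subset hT.1 hS
  have h3 : (symmDiff A B).ncard = (A \ B).ncard + (B \ A).ncard :=
    Set.ncard_union_eq disjoint_sdiff_sdiff (hA.subset Set.sdiff_subset)
      (hB.subset Set.sdiff_subset)
  have h4 := Set.ncard_inter_add_ncard_sdiff_eq_ncard A B hA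
  have h5 := Set.ncard_inter_add_ncard_sdiff_eq_ncard B A hB
  rw [Set.inter_comm] at h5
  have h6 : (T ∪ (A ∩ B)).ncard = T.ncard + (A ∩ B).ncard := by
    refine Set.ncard_union_eq ?_ hTfin hI
    rw [Set.disjoint_left]
    intro x hx hx'
    have := hT.1 hx
    rw [Set.mem_symmDiff] at this
    have := hx'.1
    have := hx'.2
    tauto
  omega

/-- The pairing is `φ` on `A' \ B'` and its inverse `ψ` on `B' \ A'`. A transversal `T` arises by
exchanging exactly those elements of `A' \ B'` that it omits. -/
theorem IsStronglyBaseReorderable.exchangeable_of_isBase {M : Matroid α}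
    (h : IsStronglyBaseReorderable M) {A B : Set α} (hA : M.IsBase A) (hB : M.IsBase B) :
    Exchangeable M A B := by
  classical
  obtain ⟨A', B', -, -, hI, hU, φ, hφ, hX⟩ := h A B hA hB
  have hS : symmDiff A B = symmDiff A' B' := by
    ext x
    have h1 := Set.ext_iff.1 hI x
    have h2 := Set.ext_iff.1 hU x
    simp only [Set.mem_inter_iff, Set.mem_union, Set.mem_symmDiff] at *
    tauto
  have hψ : ∀ y, ∃ x, y ∈ B' \ A' → x ∈ A' \ B' ∧ φ x = y := by
    intro y
    by_cases hy : y ∈ B' \ A'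
    · obtain ⟨x, hx, hxy⟩ := hφ.surjOn hy
      exact ⟨x, fun _ ↦ ⟨hx, hxy⟩⟩
    · exact ⟨y, fun h ↦ absurd h hy⟩
  choose ψ hψ using hψ
  have hl : ∀ x ∈ A' \ B', ψ (φ x) = x := fun x hx ↦
    hφ.injOn (hψ _ (hφ.mapsTo hx)).1 hx (hψ _ (hφ.mapsTo hx)).2
  have hS' : ∀ x ∈ symmDiff A' B', x ∈ A' \ B' ∨ x ∈ B' \ A' := fun x hx ↦ hx
  refine ⟨fun x ↦ if x ∈ A' then φ x else ψ x, ?_, fun T hT ↦ ?_⟩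
  · rw [hS]
    refine ⟨fun x hx ↦ ?_, fun x hx ↦ ?_, fun x hx ↦ ?_⟩ <;> rcases hS' x hx with hx | hx
    · rw [if_pos hx.1]
      exact Or.inr (hφ.mapsTo hx)
    · rw [if_neg hx.2]
      exact Or.inl (hψ x hx).1
    · rw [if_pos hx.1, if_neg (hφ.mapsTo hx).2]
      exact hl x hx
    · rw [if_neg hx.2, if_pos (hψ x hx).1.1, (hψ x hx).2]
    · rw [if_pos hx.1]
      exact fun h ↦ (hφ.mapsTo hx).2 (by rw [h]; exact hx.1)
    · rw [if_neg hx.2]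
      exact fun h ↦ hx.2 (h ▸ (hψ x hx).1.1)
  · rw [hS] at hT
    convert (hX ((A' \ B') \ T) Set.sdiff_subset).indep using 1
    rw [← hI]
    ext x
    simp only [Set.mem_union, Set.mem_inter_iff, Set.mem_sdiff, Set.mem_image]
    constructor
    · rintro (hx | hx)
      · rcases hS' x (hT.1 hx) with h | h
        · exact Or.inl ⟨h.1, fun h' ↦ h'.2 hx⟩
        · refine Or.inr ⟨ψ x, ⟨(hψ x h).1, ?_⟩, (hψ x h).2⟩
          have := (hT.2 x (hT.1 hx)).1 hx
          simpa only [if_neg h.2] using this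
      · exact Or.inl ⟨hx.1, fun h ↦ h.1.2 hx.2⟩
    · rintro (hx | ⟨y, hy, rfl⟩)
      · by_cases hB : x ∈ B'
        · exact Or.inr ⟨hx.1, hB⟩
        · left
          by_contra h'
          exact hx.2 ⟨⟨hx.1, hB⟩, h'⟩
      · left
        by_contra h'
        have := (hT.2 y (Or.inl hy.1)).2
        simp only [if_pos hy.1.1] at this
        exact hy.2 (this h')

/-- Any transversal and its complement, each joined with `A ∩ B`, serve as `A'` and `B'`, with `φ =
σ`: replacing `X` by `σ '' X` yields another transversal. Counting elements turns independence into
being a base. -/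
theorem IsStronglyBaseReorderable.of_exchangeable {M : Matroid α} [M.Finite]
    (h : ∀ A B, M.IsBase A → M.IsBase B → Exchangeable M A B) :
    IsStronglyBaseReorderable M := by
  intro A B hA hB
  obtain ⟨σ, hσ, hT⟩ := h A B hA hB
  obtain ⟨T, hT0⟩ := hσ.exists_transversal
  have hAf := M.ground_finite.subset hA.subset_ground
  have hBf := M.ground_finite.subset hB.subset_ground
  have hAB : A.ncard = B.ncard := hA.ncard_eq_ncard_of_isBase hB
  have key : ∀ T, IsTransversal σ (symmDiff A B) T → M.IsBase (T ∪ (A ∩ B)) := by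
    intro T hT'
    obtain ⟨C, hC, hTC⟩ := (hT T hT').exists_isBase_superset
    have := hT'.ncard_union hσ hAf hBf hAB
    rwa [Set.eq_of_subset_of_ncard_le hTC
      (by rw [this, hC.ncard_eq_ncard_of_isBase hA]) (M.ground_finite.subset hC.subset_ground)]
  have hTc := hT0.compl hσ
  have hd : (T ∪ A ∩ B) \ (symmDiff A B \ T ∪ A ∩ B) = T := by
    ext x
    have := @hT0.1 x
    simp only [Set.mem_sdiff, Set.mem_union, Set.mem_inter_iff, Set.mem_symmDiff] at this ⊢
    tauto
  have hd' : (symmDiff A B \ T ∪ A ∩ B) \ (T ∪ A ∩ B) = symmDiff A B \ T := by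
    ext x
    have := @hT0.1 x
    simp only [Set.mem_sdiff, Set.mem_union, Set.mem_inter_iff, Set.mem_symmDiff] at this ⊢
    tauto
  refine ⟨T ∪ (A ∩ B), (symmDiff A B \ T) ∪ (A ∩ B), key _ hT0, key _ hTc, ?_, ?_, σ, ?_, ?_⟩
  · ext x
    simp only [Set.mem_sdiff, Set.mem_union, Set.mem_inter_iff, Set.mem_symmDiff]
    tauto
  · ext x
    have := @hT0.1 x
    simp only [Set.mem_sdiff, Set.mem_union, Set.mem_inter_iff, Set.mem_symmDiff] at this ⊢
    tauto
  · rw [hd, hd']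
    refine ⟨fun x hx ↦ ⟨hσ.mapsTo x (hT0.1 hx), (hT0.2 x (hT0.1 hx)).1 hx⟩, fun x hx y hy hxy ↦ ?_,
      fun y hy ↦ ⟨σ y, ?_, hσ.invol y hy.1⟩⟩
    · rw [← hσ.invol x (hT0.1 hx), ← hσ.invol y (hT0.1 hy), hxy]
    · by_contra h'
      exact hy.2 ((hT0.2 y hy.1).2 h')
  · rw [hd]
    intro X hX
    have hX' : IsTransversal σ (symmDiff A B) ((T \ X) ∪ σ '' X) := by
      refine ⟨?_, fun x hx ↦ ?_⟩
      · rintro x (hx | ⟨x, hx, rfl⟩)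
        · exact hT0.1 hx.1
        · exact hσ.mapsTo _ (hT0.1 (hX hx))
      · have e : ∀ z ∈ symmDiff A B, (z ∈ σ '' X ↔ σ z ∈ X) := fun z hz ↦
          ⟨fun ⟨w, hw, hwz⟩ ↦ by rwa [← hwz, hσ.invol w (hT0.1 (hX hw))],
            fun h ↦ ⟨_, h, hσ.invol z hz⟩⟩
        have h1 := hσ.mapsTo x hx
        simp only [Set.mem_union, Set.mem_sdiff, e x hx, e _ h1, hσ.invol x hx]
        have := hT0.2 x hx
        have := @hX x
        have := @hX (σ x)
        tauto
    convert key _ hX' using 1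
    ext x
    have h1 := @hX x
    have h2 := @hT0.1 x
    simp only [Set.mem_sdiff, Set.mem_union, Set.mem_inter_iff, Set.mem_symmDiff] at h2 ⊢
    tauto

/-! ### From bases to equicardinal independent sets -/

/-- If independent sets of size `A.ncard + 1` are exchangeable, so are those of size `A.ncard`. -/
theorem Exchangeable.of_augment {M : Matroid α} {A B : Set α} (hA : M.Indep A) (hB : M.Indep B)
    (hAf : A.Finite) (hBf : B.Finite) (hAB : A.ncard = B.ncard) (hbase : ¬ M.IsBase A)
    (hbase' : ¬ M.IsBase B)
    (h : ∀ A' B', M.Indep A' → M.Indep B' → A'.ncard = A.ncard + 1 → B'.ncard = A.ncard + 1 →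
      Exchangeable M A' B') :
    Exchangeable M A B := by
  classical
  by_cases hx : ∃ x, x ∉ A ∧ x ∉ B ∧ M.Indep (insert x A) ∧ M.Indep (insert x B)
  · obtain ⟨x, hxA, hxB, hiA, hiB⟩ := hx
    obtain ⟨σ, hσ, hT⟩ := h _ _ hiA hiB (Set.ncard_insert_of_notMem hxA hAf)
      (by rw [Set.ncard_insert_of_notMem hxB hBf, hAB])
    have hS : symmDiff (insert x A) (insert x B) = symmDiff A B := by
      ext y
      by_cases hy : y = x <;> simp [Set.mem_symmDiff, hy, hxA, hxB]
    rw [hS] at hσ hT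
    refine ⟨σ, hσ, fun T hT' ↦ (hT T hT').subset (Set.union_subset_union_right _ ?_)⟩
    exact Set.inter_subset_inter (Set.subset_insert _ _) (Set.subset_insert _ _)
  · push Not at hx
    -- Without a common augmenting element, some element of `D \ C` augments `C`. If `x ∉ D`
    -- augments `C`, then augmenting `D` from `insert x C` must use some `y ∈ C`, and augmenting `C`
    -- from `insert y D` then uses an element of `D`.
    have aux : ∀ C D : Set α, M.Indep C → M.Indep D → C.Finite → D.Finite → C.ncard = D.ncard →
        ¬ M.IsBase C → (∀ x, x ∉ C → x ∉ D → M.Indep (insert x C) → ¬ M.Indep (insert x D)) →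
        ∃ x, x ∈ D ∧ x ∉ C ∧ M.Indep (insert x C) := by
      intro C D hC hD hCf hDf hcard hbC hCD
      obtain ⟨x, hx, hxi⟩ := hC.exists_insert_of_not_isBase hbC (M.exists_isBase.choose_spec)
      by_cases hxD : x ∈ D
      · exact ⟨x, hxD, hx.2, hxi⟩
      obtain ⟨y, hy, hyi⟩ := hD.augment hxi (by
        rw [← hDf.cast_ncard_eq, ← (hCf.insert x).cast_ncard_eq,
          Set.ncard_insert_of_notMem hx.2 hCf, ← hcard]
        exact_mod_cast Nat.lt_succ_self _)
      obtain ⟨hyC, hyD⟩ : y ∈ C ∧ y ∉ D := by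
        refine ⟨hy.1.resolve_left ?_, hy.2⟩
        rintro rfl
        exact hCD _ hx.2 hxD hxi hyi
      obtain ⟨z, ⟨hz, hzC⟩, hzi⟩ := hC.augment hyi (by
        rw [← hCf.cast_ncard_eq, ← (hDf.insert y).cast_ncard_eq,
          Set.ncard_insert_of_notMem hyD hDf, ← hcard]
        exact_mod_cast Nat.lt_succ_self _)
      refine ⟨z, hz.resolve_left ?_, hzC, hzi⟩
      rintro rfl
      exact hzC hyC
    obtain ⟨x, hxB, hxA, hxi⟩ := aux A B hA hB hAf hBf hAB hbase hx
    obtain ⟨y, hyA, hyB, hyi⟩ := aux B A hB hA hBf hAf hAB.symm hbase'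
      fun x h1 h2 h3 h4 ↦ hx x h2 h1 h4 h3
    obtain ⟨σ, hσ, hT⟩ := h _ _ hxi hyi (Set.ncard_insert_of_notMem hxA hAf)
      (by rw [Set.ncard_insert_of_notMem hyB hBf, hAB])
    have hxy : x ≠ y := fun h ↦ hxA (h ▸ hyA)
    have hS : ∀ z, z ∈ symmDiff (insert x A) (insert y B) ↔ z ∈ symmDiff A B ∧ z ≠ x ∧ z ≠ y := by
      intro z
      simp only [Set.mem_symmDiff, Set.mem_insert_iff]
      grind
    -- Both `x ∈ B` and `y ∈ A` lie in each augmented set, hence leave the symmetric difference.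
    -- They become a new pair; the lost choice between them does no harm, as the larger intersection
    -- contains both.
    refine ⟨fun z ↦ if z = x then y else if z = y then x else σ z, ⟨?_, ?_, ?_⟩, fun T hT' ↦ ?_⟩
    · intro z hz
      have := hσ.mapsTo z
      simp only [hS] at this
      simp only [Set.mem_symmDiff] at *
      grind
    · intro z hz
      have := hσ.mapsTo z
      have := hσ.invol z
      simp only [hS] at *
      grind
    · intro z hz
      have := hσ.ne z
      simp only [hS] at *
      grind
    · have hT2 : IsTransversal σ (symmDiff (insert x A) (insert y B)) (T \ {x, y}) := by
        refine ⟨fun z hz ↦ ?_, fun z hz ↦ ?_⟩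
        · rw [hS]
          have := hT'.1 hz.1
          grind
        · have h1 := hσ.mapsTo z hz
          rw [hS] at hz h1
          have := hT'.2 z hz.1
          simp only [Set.mem_sdiff, Set.mem_insert_iff, Set.mem_singleton_iff]
          grind
      refine (hT _ hT2).subset ?_
      intro z hz
      simp only [Set.mem_union, Set.mem_inter_iff, Set.mem_sdiff, Set.mem_insert_iff,
        Set.mem_singleton_iff] at *
      grind

/-- Equicardinal independent sets are exchangeable as soon as bases are. -/
theorem exchangeable_of_forall_isBase {M : Matroid α} [M.Finite]
    (h : ∀ A B, M.IsBase A → M.IsBase B → Exchangeable M A B) {A B : Set α} (hA : M.Indep A)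
    (hB : M.Indep B) (hAB : A.ncard = B.ncard) : Exchangeable M A B := by
  have hfin : ∀ I, M.Indep I → I.Finite := fun I hI ↦ M.ground_finite.subset hI.subset_ground
  obtain ⟨C, hC⟩ := M.exists_isBase
  have hle : ∀ I, M.Indep I → I.ncard ≤ C.ncard := fun I hI ↦ by
    obtain ⟨B', hB', hIB'⟩ := hI.exists_isBase_superset
    rw [hC.ncard_eq_ncard_of_isBase hB']
    exact Set.ncard_le_ncard hIB' (hfin _ hB'.indep)
  have hbase : ∀ I, M.Indep I → (I.ncard = C.ncard ↔ M.IsBase I) := fun I hI ↦ by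
    refine ⟨fun h ↦ ?_, fun h ↦ h.ncard_eq_ncard_of_isBase hC⟩
    obtain ⟨B', hB', hIB'⟩ := hI.exists_isBase_superset
    rwa [Set.eq_of_subset_of_ncard_le hIB' (by rw [h, hC.ncard_eq_ncard_of_isBase hB'])
      (hfin _ hB'.indep)]
  -- The induction is on the corank; corank zero is the case of bases.
  induction hn : C.ncard - A.ncard generalizing A B with
  | zero =>
    have := hle A hA
    exact h A B ((hbase A hA).1 (by omega)) ((hbase B hB).1 (by omega))
  | succ n ih =>
    refine .of_augment hA hB (hfin A hA) (hfin B hB) hAB (fun h ↦ ?_) (fun h ↦ ?_)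
      fun A' B' hA' hB' h1 h2 ↦ ih hA' hB' (by omega) (by omega)
    · rw [← hbase A hA] at h
      omega
    · rw [← hbase B hB] at h
      omega

/-- A finite matroid is strongly base reorderable if and only if any two independent sets of the
same size are exchangeable. -/
theorem isStronglyBaseReorderable_iff {M : Matroid α} [M.Finite] :
    IsStronglyBaseReorderable M ↔ ∀ A B, M.Indep A → M.Indep B → A.ncard = B.ncard →
      Exchangeable M A B :=
  ⟨fun h _ _ hA hB hAB ↦ exchangeable_of_forall_isBase
      (fun _ _ hA hB ↦ h.exchangeable_of_isBase hA hB) hA hB hAB,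
    fun h ↦ .of_exchangeable fun A B hA hB ↦ h A B hA.indep hB.indep
      (hA.ncard_eq_ncard_of_isBase hB)⟩

/-! ### Restriction, duality, minors, truncation and sums -/

theorem IsStronglyBaseReorderable.restrict {M : Matroid α} [M.Finite] {R : Set α}
    (hR : R.Finite) (h : IsStronglyBaseReorderable M) : IsStronglyBaseReorderable (M.restrict R) := by
  have : (M.restrict R).Finite := Matroid.restrict_finite hR
  rw [isStronglyBaseReorderable_iff] at h ⊢
  intro A B hA hB hAB
  rw [Matroid.restrict_indep_iff] at hA hB
  obtain ⟨σ, hσ, hT⟩ := h A B hA.1 hB.1 hAB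
  refine ⟨σ, hσ, fun T hT' ↦ Matroid.restrict_indep_iff.2 ⟨hT T hT', ?_⟩⟩
  refine Set.union_subset (hT'.1.trans ?_) (Set.inter_subset_left.trans hA.2)
  exact Set.symmDiff_subset_union.trans (Set.union_subset hA.2 hB.2)

/-- Complementary bases have the same symmetric difference, so the same pairing works: the
complement of `T ∪ (A ∩ B)` is the complementary transversal together with the intersection of the
complements. -/
theorem IsStronglyBaseReorderable.dual {M : Matroid α} [M.Finite]
    (h : IsStronglyBaseReorderable M) : IsStronglyBaseReorderable M.dual := by
  refine .of_exchangeable fun A B hA hB ↦ ?_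
  obtain ⟨σ, hσ, hT⟩ := h.exchangeable_of_isBase hA.compl_isBase_of_dual hB.compl_isBase_of_dual
  have hAE : A ⊆ M.E := hA.subset_ground
  have hBE : B ⊆ M.E := hB.subset_ground
  have hS : symmDiff (M.E \ A) (M.E \ B) = symmDiff A B := by
    ext x
    have h1 := @hAE x
    have h2 := @hBE x
    simp only [Set.mem_symmDiff, Set.mem_sdiff]
    tauto
  rw [hS] at hσ hT
  refine ⟨σ, hσ, fun T hT' ↦ ?_⟩
  obtain ⟨C, hC, hCT⟩ := (hT _ (hT'.compl hσ)).exists_isBase_superset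
  have hfin : ∀ X ⊆ M.E, X.Finite := fun X hX ↦ M.ground_finite.subset hX
  have hcard := IsTransversal.ncard_union (A := M.E \ A) (B := M.E \ B) (by rwa [hS])
    (hfin _ Set.sdiff_subset) (hfin _ Set.sdiff_subset)
    (hA.compl_isBase_of_dual.ncard_eq_ncard_of_isBase hB.compl_isBase_of_dual)
    (by rw [hS]; exact hT'.compl hσ)
  rw [← Set.eq_of_subset_of_ncard_le hCT (by
    rw [hcard, hC.ncard_eq_ncard_of_isBase hA.compl_isBase_of_dual])
    (hfin _ hC.subset_ground)] at hC
  convert hC.compl_isBase_dual.indep using 1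
  ext x
  have h1 := @hAE x
  have h2 := @hBE x
  have h3 := @hT'.1 x
  simp only [Set.mem_symmDiff, Set.mem_sdiff, Set.mem_union, Set.mem_inter_iff] at *
  tauto

theorem IsStronglyBaseReorderable.isMinor {M N : Matroid α} [M.Finite] (hN : N.IsMinor M)
    (h : IsStronglyBaseReorderable M) : IsStronglyBaseReorderable N := by
  obtain ⟨C, D, rfl⟩ := hN
  have hc : IsStronglyBaseReorderable (M.contract C) := by
    rw [Matroid.contract]
    have := h.dual.restrict (R := M.E \ C) (M.ground_finite.subset Set.sdiff_subset)
    have hf : (M.dual.restrict (M.E \ C)).Finite :=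
      Matroid.restrict_finite (M.ground_finite.subset Set.sdiff_subset)
    exact this.dual
  exact hc.restrict ((M.contract C).ground_finite.subset Set.sdiff_subset)

theorem truncation_indep_iff {M : Matroid α} [M.Finite] {k : ℕ} {I : Set α} :
    (truncation M k).Indep I ↔ M.Indep I ∧ I.ncard ≤ k := by
  simp [truncation]

instance truncation_finite {M : Matroid α} [M.Finite] {k : ℕ} : (truncation M k).Finite :=
  ⟨M.ground_finite⟩

/-- Every set produced by a transversal has the size of `A`, so the bound `k` is preserved. -/
theorem IsStronglyBaseReorderable.truncation {M : Matroid α} [M.Finite]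
    (h : IsStronglyBaseReorderable M) (k : ℕ) :
    IsStronglyBaseReorderable (SBRO.truncation M k) := by
  rw [isStronglyBaseReorderable_iff] at h ⊢
  intro A B hA hB hAB
  rw [truncation_indep_iff] at hA hB
  obtain ⟨σ, hσ, hT⟩ := h A B hA.1 hB.1 hAB
  refine ⟨σ, hσ, fun T hT' ↦ truncation_indep_iff.2 ⟨hT T hT', ?_⟩⟩
  rw [hT'.ncard_union hσ (M.ground_finite.subset hA.1.subset_ground)
    (M.ground_finite.subset hB.1.subset_ground) hAB]
  exact hA.2

theorem IsTransversal.preimage {f : α → β} {σ : α → α} {ρ : β → β} {A B T : Set β}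
    (hρ : ∀ x, ρ (f x) = f (σ x))
    (hT : IsTransversal ρ (symmDiff A B) T) :
    IsTransversal σ (symmDiff (f ⁻¹' A) (f ⁻¹' B)) (f ⁻¹' T) := by
  refine ⟨fun x hx ↦ hT.1 hx, fun x hx ↦ ?_⟩
  rw [Set.mem_preimage, Set.mem_preimage, ← hρ]
  exact hT.2 (f x) hx

theorem IsStronglyBaseReorderable.sum {M : Matroid α} {N : Matroid β} [M.Finite] [N.Finite]
    (hM : IsStronglyBaseReorderable M) (hN : IsStronglyBaseReorderable N) :
    IsStronglyBaseReorderable (M.sum N) := by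
  have hf : (M.sum N).Finite := ⟨by
    rw [Matroid.sum_ground]
    exact (M.ground_finite.image _).union (N.ground_finite.image _)⟩
  refine .of_exchangeable fun A B hA hB ↦ ?_
  rw [Matroid.sum_isBase_iff] at hA hB
  obtain ⟨σ, hσ, hT⟩ := hM.exchangeable_of_isBase hA.1 hB.1
  obtain ⟨τ, hτ, hT'⟩ := hN.exchangeable_of_isBase hA.2 hB.2
  refine ⟨Sum.map σ τ, ⟨?_, ?_, ?_⟩, fun T hTr ↦ ?_⟩
  · rintro (x | x) hx
    · exact hσ.mapsTo x hx
    · exact hτ.mapsTo x hx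
  · rintro (x | x) hx
    · exact congrArg Sum.inl (hσ.invol x hx)
    · exact congrArg Sum.inr (hτ.invol x hx)
  · rintro (x | x) hx h
    · exact hσ.ne x hx (Sum.inl_injective h)
    · exact hτ.ne x hx (Sum.inr_injective h)
  · rw [Matroid.sum_indep_iff]
    exact ⟨hT _ (hTr.preimage fun _ ↦ rfl), hT' _ (hTr.preimage fun _ ↦ rfl)⟩

/-! ### Images and preimages under maps -/

/-- A pairing can be pushed forward along a map with fibres of size at most two: each transversal
of the new pairing, together with the images of the two-element fibres, is the image of a
transversal. -/
theorem IsPairing.exists_image {σ : β → β} {S : Set β} (hS : S.Finite) (hσ : IsPairing σ S)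
    (g : β → α) (hg : ∀ x ∈ S, ∀ y ∈ S, ∀ z ∈ S, g x = g y → g y = g z → x = y ∨ y = z ∨ x = z) :
    ∃ τ : α → α, IsPairing τ {a | ∃! x, x ∈ S ∧ g x = a} ∧
      ∀ T, IsTransversal τ {a | ∃! x, x ∈ S ∧ g x = a} T → ∃ T', IsTransversal σ S T' ∧
        g '' T' = T ∪ {a | ∃ x ∈ S, ∃ y ∈ S, x ≠ y ∧ g x = a ∧ g y = a} := by
  classical
  induction hn : S.ncard using Nat.strong_induction_on generalizing S σ with
  | _ n ih =>
  by_cases hinj : Set.InjOn g S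
  · have hU : ∀ a, (∃! x, x ∈ S ∧ g x = a) ↔ ∃ x ∈ S, g x = a := fun a ↦
      ⟨fun ⟨x, hx, _⟩ ↦ ⟨x, hx⟩, fun ⟨x, hx, hxa⟩ ↦ ⟨x, ⟨hx, hxa⟩, fun y hy ↦
        hinj hy.1 hx (hy.2.trans hxa.symm)⟩⟩
    simp only [hU]
    have hτ : ∀ a, ∃ b, ∀ x ∈ S, g x = a → b = g (σ x) := by
      intro a
      by_cases ha : ∃ x ∈ S, g x = a
      · obtain ⟨x, hx, rfl⟩ := ha
        exact ⟨g (σ x), fun y hy hyx ↦ by rw [hinj hy hx hyx]⟩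
      · exact ⟨a, fun x hx hxa ↦ absurd ⟨x, hx, hxa⟩ ha⟩
    choose τ hτ using hτ
    have hτ' : ∀ x ∈ S, τ (g x) = g (σ x) := fun x hx ↦ hτ _ x hx rfl
    refine ⟨τ, ⟨?_, ?_, ?_⟩, fun T hT ↦ ⟨{x ∈ S | g x ∈ T}, ⟨fun x hx ↦ hx.1, fun x hx ↦ ?_⟩, ?_⟩⟩
    · rintro _ ⟨x, hx, rfl⟩
      exact ⟨σ x, hσ.mapsTo x hx, (hτ' x hx).symm⟩
    · rintro _ ⟨x, hx, rfl⟩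
      rw [hτ' x hx, hτ' _ (hσ.mapsTo x hx), hσ.invol x hx]
    · rintro _ ⟨x, hx, rfl⟩ h
      rw [hτ' x hx] at h
      exact hσ.ne x hx (hinj (hσ.mapsTo x hx) hx h)
    · have h1 := hT.2 (g x) ⟨x, hx, rfl⟩
      rw [hτ' x hx] at h1
      have h2 := hσ.mapsTo x hx
      simp only [Set.mem_ofPred_eq, hx, h2, true_and]
      exact h1
    · ext a
      constructor
      · rintro ⟨x, hx, rfl⟩
        exact Or.inl hx.2
      · rintro (ha | ⟨x, hx, y, hy, hxy, rfl, h⟩)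
        · obtain ⟨x, hx, rfl⟩ := hT.1 ha
          exact ⟨x, ⟨hx, ha⟩, rfl⟩
        · exact absurd (hinj hx hy h.symm) hxy
  · obtain ⟨p, hp, q, hq, hpq, hne⟩ : ∃ p ∈ S, ∃ q ∈ S, g p = g q ∧ p ≠ q := by
      simpa [Set.InjOn] using hinj
    have hfib : ∀ x ∈ S, g x = g p → x = p ∨ x = q := by
      intro x hx hxp
      have := hg x hx p hp q hq hxp hpq
      tauto
    -- Deleting the fibre `{p, q}` leaves the partners of `p` and `q` to be paired with each other;
    -- if `p` and `q` are partners, nothing else changes.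
    set ρ : β → β := fun z ↦ if σ z = p then σ q else if σ z = q then σ p else σ z with hρ
    have hmem : ∀ z, z ∈ S \ {p, q} ↔ z ∈ S ∧ z ≠ p ∧ z ≠ q := by simp
    have hρp : IsPairing ρ (S \ {p, q}) := by
      obtain ⟨h1, h2, h3⟩ := hσ
      have := h1 p hp
      have := h1 q hq
      have := h2 p hp
      have := h2 q hq
      have := h3 p hp
      have := h3 q hq
      refine ⟨fun z hz ↦ ?_, fun z hz ↦ ?_, fun z hz ↦ ?_⟩ <;> rw [hmem] at * <;>
        have := h1 z hz.1 <;> have := h2 z hz.1 <;> have := h3 z hz.1 <;> grind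
    have hlt : (S \ {p, q}).ncard < n := by
      rw [← hn]
      exact Set.ncard_lt_ncard ⟨Set.sdiff_subset, fun h ↦ (h hp).2 (Or.inl rfl)⟩ hS
    obtain ⟨τ, hτ, hT⟩ := ih _ hlt (hS.subset Set.sdiff_subset) hρp
      (fun x hx y hy z hz ↦ hg x hx.1 y hy.1 z hz.1) rfl
    have hU : {a | ∃! x, x ∈ S \ {p, q} ∧ g x = a} = {a | ∃! x, x ∈ S ∧ g x = a} := by
      ext a
      constructor
      · rintro ⟨x, ⟨hx, hxa⟩, hu⟩
        rw [hmem] at hx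
        refine ⟨x, ⟨hx.1, hxa⟩, fun y hy ↦ hu y ⟨?_, hy.2⟩⟩
        have := hfib x hx.1
        rw [hmem]
        grind
      · rintro ⟨x, ⟨hx, hxa⟩, hu⟩
        have h1 := hu p
        have h2 := hu q
        refine ⟨x, ⟨?_, hxa⟩, fun y hy ↦ hu y ⟨hy.1.1, hy.2⟩⟩
        rw [hmem]
        grind
    rw [hU] at hτ hT
    refine ⟨τ, hτ, fun T hTt ↦ ?_⟩
    obtain ⟨T', hT', hgT'⟩ := hT T hTt
    -- When `p` and `q` are not partners, `T'` contains exactly one of `σ p` and `σ q`; `r` is the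
    -- one of `p`, `q` whose partner is missing. Either choice contributes the same value `g p`.
    set r := if σ p ∈ T' then q else p with hr
    have hT'S : ∀ z ∈ T', z ∈ S ∧ z ≠ p ∧ z ≠ q := fun z hz ↦ (hmem z).1 (hT'.1 hz)
    refine ⟨insert r T', ⟨?_, fun x hx ↦ ?_⟩, ?_⟩
    · refine Set.insert_subset ?_ fun z hz ↦ (hT'S z hz).1
      grind
    · have hT'2 : ∀ x ∈ S, x ≠ p → x ≠ q → (x ∈ T' ↔ ρ x ∉ T') := fun x h1 h2 h3 ↦
        hT'.2 x ((hmem x).2 ⟨h1, h2, h3⟩)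
      have hpT := fun h ↦ (hT'S p h).2.1 rfl
      have hqT := fun h ↦ (hT'S q h).2.2 rfl
      obtain ⟨h1, h2, h3⟩ := hσ
      have := h1 p hp
      have := h1 q hq
      have := h2 p hp
      have := h2 q hq
      have := h3 p hp
      have := h3 q hq
      have := h1 x hx
      have := h2 x hx
      have := h3 x hx
      have := hT'2 x hx
      have := hT'2 (σ p) (h1 p hp)
      have := hT'2 (σ q) (h1 q hq)
      simp only [Set.mem_insert_iff]
      grind
    · have hgr : g r = g p := by grind
      rw [Set.image_insert_eq, hgT', hgr]
      ext a
      simp only [Set.mem_insert_iff, Set.mem_union, Set.mem_ofPred_eq]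
      constructor
      · rintro (rfl | h | ⟨x, hx, y, hy, h⟩)
        · exact Or.inr ⟨p, hp, q, hq, hne, rfl, hpq.symm⟩
        · exact Or.inl h
        · exact Or.inr ⟨x, hx.1, y, hy.1, h⟩
      · rintro (h | ⟨x, hx, y, hy, h⟩)
        · exact Or.inr (Or.inl h)
        · by_cases ha : a = g p
          · exact Or.inl ha
          · refine Or.inr (Or.inr ⟨x, (hmem x).2 ⟨hx, ?_⟩, y, (hmem y).2 ⟨hy, ?_⟩, h⟩) <;> grind

/-- The independent sets of `N` are the images under `g` of the independent sets of `M`. -/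
def IsImage (g : β → α) (M : Matroid β) (N : Matroid α) : Prop :=
  ∀ I, N.Indep I ↔ ∃ J, M.Indep J ∧ g '' J = I

theorem IsImage.exists_bijOn {g : β → α} {M : Matroid β} {N : Matroid α} (h : IsImage g M N)
    {I : Set α} (hI : N.Indep I) : ∃ J, M.Indep J ∧ Set.BijOn g J I := by
  obtain ⟨J, hJ, rfl⟩ := (h I).1 hI
  obtain ⟨J', hJ', hb⟩ := (Set.surjOn_image g J).exists_bijOn_subset
  exact ⟨J', hJ.subset hJ', hb⟩

/-- Lift `A` and `B` bijectively to independent `F` and `G`. A fibre meets each of them at most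
once, so values attained once on their symmetric difference form that of `A` and `B`, while values
attained twice, together with the image of `F ∩ G`, form `A ∩ B`. -/
theorem IsStronglyBaseReorderable.of_isImage {g : β → α} {M : Matroid β} {N : Matroid α}
    [M.Finite] [N.Finite] (hg : IsImage g M N) (h : IsStronglyBaseReorderable M) :
    IsStronglyBaseReorderable N := by
  rw [isStronglyBaseReorderable_iff] at h ⊢
  intro A B hA hB hAB
  obtain ⟨F, hF, hFA⟩ := hg.exists_bijOn hA
  obtain ⟨G, hG, hGB⟩ := hg.exists_bijOn hB
  have hFG : F.ncard = G.ncard := by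
    rw [← Set.InjOn.ncard_image hFA.injOn, ← Set.InjOn.ncard_image hGB.injOn,
      hFA.image_eq, hGB.image_eq, hAB]
  obtain ⟨σ, hσ, hT⟩ := h F G hF hG hFG
  have hFf := M.ground_finite.subset hF.subset_ground
  have hGf := M.ground_finite.subset hG.subset_ground
  have hFi : ∀ x ∈ F, ∀ y ∈ F, g x = g y → x = y := fun x hx y hy ↦ hFA.injOn hx hy
  have hGi : ∀ x ∈ G, ∀ y ∈ G, g x = g y → x = y := fun x hx y hy ↦ hGB.injOn hx hy
  have hmA : ∀ a, a ∈ A ↔ ∃ x ∈ F, g x = a := fun a ↦ by rw [← hFA.image_eq]; rfl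
  have hmB : ∀ a, a ∈ B ↔ ∃ x ∈ G, g x = a := fun a ↦ by rw [← hGB.image_eq]; rfl
  obtain ⟨τ, hτ, hT'⟩ := hσ.exists_image (hFf.symmDiff hGf) g (by
    intro x hx y hy z hz
    rw [Set.mem_symmDiff] at *
    grind)
  have hU : {a | ∃! x, x ∈ symmDiff F G ∧ g x = a} = symmDiff A B := by
    ext a
    simp only [Set.mem_symmDiff, Set.mem_ofPred_eq]
    constructor
    · rintro ⟨x, ⟨hx, rfl⟩, hu⟩
      rcases hx with hx | hx
      · refine Or.inl ⟨(hmA _).2 ⟨x, hx.1, rfl⟩, fun hb ↦ ?_⟩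
        obtain ⟨y, hy, hyx⟩ := (hmB _).1 hb
        by_cases hyF : y ∈ F
        · exact hx.2 (hFi x hx.1 y hyF hyx.symm ▸ hy)
        · exact hx.2 (hu y ⟨Or.inr ⟨hy, hyF⟩, hyx⟩ ▸ hy)
      · refine Or.inr ⟨(hmB _).2 ⟨x, hx.1, rfl⟩, fun hb ↦ ?_⟩
        obtain ⟨y, hy, hyx⟩ := (hmA _).1 hb
        by_cases hyG : y ∈ G
        · exact hx.2 (hGi x hx.1 y hyG hyx.symm ▸ hy)
        · exact hx.2 (hu y ⟨Or.inl ⟨hy, hyG⟩, hyx⟩ ▸ hy)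
    · rintro (⟨ha, hb⟩ | ⟨ha, hb⟩)
      · obtain ⟨x, hx, rfl⟩ := (hmA _).1 ha
        have h1 : ∀ y, g y = g x → y ∉ G := fun y h hy ↦ hb ((hmB _).2 ⟨y, hy, h⟩)
        refine ⟨x, ⟨Or.inl ⟨hx, h1 x rfl⟩, rfl⟩, fun y hy ↦ ?_⟩
        have := h1 y
        grind
      · obtain ⟨x, hx, rfl⟩ := (hmB _).1 ha
        have h1 : ∀ y, g y = g x → y ∉ F := fun y h hy ↦ hb ((hmA _).2 ⟨y, hy, h⟩)
        refine ⟨x, ⟨Or.inr ⟨hx, h1 x rfl⟩, rfl⟩, fun y hy ↦ ?_⟩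
        have := h1 y
        grind
  rw [hU] at hτ hT'
  refine ⟨τ, hτ, fun T hTt ↦ (hg _).2 ?_⟩
  obtain ⟨T', hTt', hgT⟩ := hT' T hTt
  refine ⟨_, hT T' hTt', ?_⟩
  rw [Set.image_union, hgT, Set.union_assoc]
  congr 1
  ext a
  simp only [Set.mem_union, Set.mem_ofPred_eq, Set.mem_image, Set.mem_inter_iff, hmA, hmB,
    Set.mem_symmDiff]
  constructor
  · rintro (⟨x, hx, y, hy, hxy⟩ | ⟨x, hx, rfl⟩)
    · grind
    · exact ⟨⟨x, hx.1, rfl⟩, ⟨x, hx.2, rfl⟩⟩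
  · rintro ⟨⟨x, hx, rfl⟩, ⟨y, hy, hyx⟩⟩
    by_cases hxy : x = y
    · subst hxy
      exact Or.inr ⟨x, ⟨hx, hy⟩, rfl⟩
    · left
      refine ⟨x, ?_, y, ?_, hxy, rfl, hyx⟩ <;> grind

/-- The images of the independent sets of a finite matroid are the independent sets of a matroid. -/
theorem exists_isImage (g : β → α) (M : Matroid β) [M.Finite] {E : Set α} (hE : E.Finite)
    (hgE : Set.MapsTo g M.E E) : ∃ N : Matroid α, N.E = E ∧ IsImage g M N := by
  classical
  refine ⟨(IndepMatroid.ofFinite hE (fun I ↦ ∃ J, M.Indep J ∧ g '' J = I)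
    ⟨∅, M.empty_indep, by simp⟩ ?_ ?_ ?_).matroid, rfl, fun I ↦ Iff.rfl⟩
  · rintro I _ ⟨K, hK, rfl⟩ hIJ
    refine ⟨K ∩ g ⁻¹' I, hK.subset Set.inter_subset_left, ?_⟩
    rw [Set.image_inter_preimage, Set.inter_eq_right.2 hIJ]
  · intro I J hI hJ hIJ
    -- Augment `F` by some `e ∈ G`. If `g e` is already in `I`, exchange `e` for the element `f` of
    -- `F` above it: the image is kept, and `F \ G` shrinks because `g` is injective on `G`.
    have key : ∀ n, ∀ F G, M.Indep F → M.Indep G → Set.BijOn g F I → Set.BijOn g G J →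
        (F \ G).ncard = n → ∃ e ∈ J, e ∉ I ∧ ∃ K, M.Indep K ∧ g '' K = insert e I := by
      intro n
      induction n using Nat.strong_induction_on with
      | _ n ih =>
      intro F G hF hG hFI hGJ hn
      have hFf := M.ground_finite.subset hF.subset_ground
      have hGf := M.ground_finite.subset hG.subset_ground
      obtain ⟨e, he, hei⟩ := hF.augment hG (by
        rw [← hFf.cast_ncard_eq, ← hGf.cast_ncard_eq]
        rw [← hFI.image_eq, ← hGJ.image_eq, Set.InjOn.ncard_image hFI.injOn,
          Set.InjOn.ncard_image hGJ.injOn] at hIJ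
        exact_mod_cast hIJ)
      by_cases heI : g e ∈ I
      · obtain ⟨f, hf, hfe⟩ := hFI.surjOn heI
        have hfG : f ∉ G := fun h ↦ he.2 (hGJ.injOn h he.1 hfe ▸ hf)
        refine ih _ ?_ (insert e (F \ {f})) G
          (hei.subset (Set.insert_subset_insert Set.sdiff_subset)) hG ⟨?_, ?_, ?_⟩ hGJ rfl
        · rw [← hn]
          refine Set.ncard_lt_ncard ⟨?_, fun h ↦ ?_⟩ (hFf.subset Set.sdiff_subset)
          · rintro x ⟨rfl | hx, hxG⟩
            · exact absurd he.1 hxG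
            · exact ⟨hx.1, hxG⟩
          · have := h ⟨hf, hfG⟩
            have := he.1
            grind
        · rintro x (rfl | hx)
          · exact heI
          · exact hFI.mapsTo hx.1
        · have := hFI.injOn
          intro x hx y hy hxy
          have h1 : ∀ x ∈ F, ∀ y ∈ F, g x = g y → x = y := fun x hx y hy ↦ hFI.injOn hx hy
          simp only [Set.mem_insert_iff, Set.mem_sdiff, Set.mem_singleton_iff] at hx hy
          grind
        · intro a ha
          obtain ⟨x, hx, rfl⟩ := hFI.surjOn ha
          by_cases hxf : x = f
          · exact ⟨e, Or.inl rfl, by rw [hxf, hfe]⟩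
          · exact ⟨x, Or.inr ⟨hx, hxf⟩, rfl⟩
      · exact ⟨g e, hGJ.mapsTo he.1, heI, _, hei, by rw [Set.image_insert_eq, hFI.image_eq]⟩
    have hbij : ∀ I, (∃ J, M.Indep J ∧ g '' J = I) → ∃ J, M.Indep J ∧ Set.BijOn g J I := by
      rintro _ ⟨J, hJ, rfl⟩
      obtain ⟨J', hJ', hb⟩ := (Set.surjOn_image g J).exists_bijOn_subset
      exact ⟨J', hJ.subset hJ', hb⟩
    obtain ⟨F, hF, hFI⟩ := hbij I hI
    obtain ⟨G, hG, hGJ⟩ := hbij J hJ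
    exact key _ F G hF hG hFI hGJ rfl
  · rintro _ ⟨J, hJ, rfl⟩
    exact Set.image_subset_iff.2 fun x hx ↦ hgE (hJ.subset_ground hx)

theorem IsStronglyBaseReorderable.map {M : Matroid β} [M.Finite] {f : β → α}
    (hf : Set.InjOn f M.E) (h : IsStronglyBaseReorderable M) :
    IsStronglyBaseReorderable (M.map f hf) :=
  h.of_isImage (g := f) fun I ↦ by
    rw [Matroid.map_indep_iff]
    exact ⟨fun ⟨J, hJ, h⟩ ↦ ⟨J, hJ, h.symm⟩, fun ⟨J, hJ, h⟩ ↦ ⟨J, hJ, h.symm⟩⟩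

/-- An element of the symmetric difference either shares its fibre with exactly one other, and these
two are paired, or is the only one over a point of the symmetric difference of the images, where `σ`
is lifted. A transversal splits every shared fibre, so `f` stays injective on the resulting set. -/
theorem IsStronglyBaseReorderable.comap {M : Matroid α} [M.Finite] {f : β → α}
    [(M.comap f).Finite] (h : IsStronglyBaseReorderable M) :
    IsStronglyBaseReorderable (M.comap f) := by
  classical
  rw [isStronglyBaseReorderable_iff] at h ⊢
  intro A B hA hB hAB
  rw [Matroid.comap_indep_iff] at hA hB
  obtain ⟨hA, hAi⟩ := hA
  obtain ⟨hB, hBi⟩ := hB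
  obtain ⟨σ, hσ, hT⟩ := h _ _ hA hB (by
    rw [Set.InjOn.ncard_image hAi, Set.InjOn.ncard_image hBi, hAB])
  have hAi : ∀ x ∈ A, ∀ y ∈ A, f x = f y → x = y := fun x hx y hy ↦ hAi hx hy
  have hBi : ∀ x ∈ B, ∀ y ∈ B, f x = f y → x = y := fun x hx y hy ↦ hBi hx hy
  have hfib : ∀ x ∈ symmDiff A B, (∃ y ∈ symmDiff A B, y ≠ x ∧ f y = f x) ∨
      f x ∈ symmDiff (f '' A) (f '' B) := by
    intro x hx
    simp only [Set.mem_symmDiff, Set.mem_image] at *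
    grind
  have hlift : ∀ a ∈ symmDiff (f '' A) (f '' B), ∃ x ∈ symmDiff A B, f x = a := by
    rintro a (⟨⟨x, hx, rfl⟩, hb⟩ | ⟨⟨x, hx, rfl⟩, hb⟩)
    · exact ⟨x, Or.inl ⟨hx, fun h ↦ hb ⟨x, h, rfl⟩⟩, rfl⟩
    · exact ⟨x, Or.inr ⟨hx, fun h ↦ hb ⟨x, h, rfl⟩⟩, rfl⟩
  have huniq : ∀ x ∈ symmDiff A B, ∀ y ∈ symmDiff A B, f x = f y →
      f x ∈ symmDiff (f '' A) (f '' B) → x = y := by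
    intro x hx y hy hxy h
    simp only [Set.mem_symmDiff, Set.mem_image] at *
    grind
  have hthree : ∀ x ∈ symmDiff A B, ∀ y ∈ symmDiff A B, ∀ z ∈ symmDiff A B, f x = f y → f y = f z →
      x = y ∨ y = z ∨ x = z := by
    intro x hx y hy z hz
    simp only [Set.mem_symmDiff] at *
    grind
  have hex : ∀ x, ∃ y, x ∈ symmDiff A B → y ∈ symmDiff A B ∧ ((y ≠ x ∧ f y = f x) ∨
      (f x ∈ symmDiff (f '' A) (f '' B) ∧ f y = σ (f x))) := by
    intro x
    by_cases hx : x ∈ symmDiff A B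
    · rcases hfib x hx with ⟨y, hy, h⟩ | h
      · exact ⟨y, fun _ ↦ ⟨hy, Or.inl h⟩⟩
      · obtain ⟨y, hy, hyx⟩ := hlift _ (hσ.mapsTo _ h)
        exact ⟨y, fun _ ↦ ⟨hy, Or.inr ⟨h, hyx⟩⟩⟩
    · exact ⟨x, fun h ↦ absurd h hx⟩
  choose τ hτ using hex
  have hτσ : ∀ x ∈ symmDiff A B, f x ∈ symmDiff (f '' A) (f '' B) → f (τ x) = σ (f x) := by
    intro x hx hfx
    rcases (hτ x hx).2 with h | h
    · exact absurd (huniq x hx _ (hτ x hx).1 h.2.symm hfx).symm h.1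
    · exact h.2
  refine ⟨τ, ⟨fun x hx ↦ (hτ x hx).1, fun x hx ↦ ?_, fun x hx ↦ ?_⟩, fun T hTt ↦ ?_⟩
  · have h1 := hτ x hx
    have h2 := hτ _ h1.1
    rcases h1.2 with h | h
    · have := hthree _ h2.1 _ h1.1 x hx
      have := huniq _ h1.1 _ hx h.2
      grind
    · have h3 := hσ.mapsTo _ h.1
      rw [← h.2] at h3
      refine (huniq _ hx _ h2.1 ?_ h.1).symm
      rw [hτσ _ h1.1 h3, h.2, hσ.invol _ h.1]
  · rcases (hτ x hx).2 with h | h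
    · exact h.1
    · intro h'
      rw [h'] at h
      exact hσ.ne _ h.1 h.2.symm
  · have hTr : IsTransversal σ (symmDiff (f '' A) (f '' B))
        (f '' T ∩ symmDiff (f '' A) (f '' B)) := by
      refine ⟨Set.inter_subset_right, fun a ha ↦ ?_⟩
      obtain ⟨x, hx, rfl⟩ := hlift a ha
      have h1 : ∀ y ∈ symmDiff A B, f y ∈ symmDiff (f '' A) (f '' B) →
          (f y ∈ f '' T ↔ y ∈ T) := fun y hy hfy ↦
        ⟨fun ⟨z, hz, hzy⟩ ↦ by rwa [huniq y hy z (hTt.1 hz) hzy.symm hfy],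
          fun h ↦ ⟨y, h, rfl⟩⟩
      have h2 := hσ.mapsTo _ ha
      have h3 := hTt.2 x hx
      rw [← hτσ x hx ha] at h2 ⊢
      rw [Set.mem_inter_iff, Set.mem_inter_iff, h1 x hx ha, h1 _ (hτ x hx).1 h2]
      tauto
    rw [Matroid.comap_indep_iff]
    refine ⟨(hT _ hTr).subset ?_, ?_⟩
    · rintro _ ⟨x, hx | hx, rfl⟩
      · by_cases h' : f x ∈ symmDiff (f '' A) (f '' B)
        · exact Or.inl ⟨⟨x, hx, rfl⟩, h'⟩
        · right
          rcases hTt.1 hx with ⟨hA', -⟩ | ⟨hB', -⟩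
          · refine ⟨⟨x, hA', rfl⟩, ?_⟩
            by_contra h''
            exact h' (Or.inl ⟨⟨x, hA', rfl⟩, h''⟩)
          · refine ⟨?_, ⟨x, hB', rfl⟩⟩
            by_contra h''
            exact h' (Or.inr ⟨⟨x, hB', rfl⟩, h''⟩)
      · exact Or.inr ⟨⟨x, hx.1, rfl⟩, ⟨x, hx.2, rfl⟩⟩
    · intro x hx y hy hxy
      by_contra hne
      have hxT : x ∈ symmDiff A B ∧ y ∈ symmDiff A B ∧ x ∈ T ∧ y ∈ T := by
        have h1 := @hTt.1 x
        have h2 := @hTt.1 y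
        simp only [Set.mem_symmDiff, Set.mem_union, Set.mem_inter_iff] at *
        grind
      obtain ⟨hxS, hyS, hxT, hyT⟩ := hxT
      have h1 := hτ x hxS
      have h2 : f x ∉ symmDiff (f '' A) (f '' B) := fun h ↦ hne (huniq x hxS y hyS hxy h)
      have h3 := (hTt.2 x hxS).1 hxT
      have h4 := hthree _ h1.1 x hxS y hyS
      grind

/-! ### Linkings and injections between complements -/

/-- `f` sends each element of `Z` to itself or to an out-neighbour. -/
def IsStep (D : Digraph V) (f : V → V) (Z : Set V) : Prop :=
  ∀ u ∈ Z, f u = u ∨ D.Adj u (f u)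

/-- A set linked to `I` yields an injection from the complement of `I` into the complement
of the set. -/
theorem IsLinked.exists_step {D : Digraph V} {X I : Set V} (h : IsLinked D X I) :
    ∃ f : V → V, Set.InjOn f Iᶜ ∧ Set.MapsTo f Iᶜ Xᶜ ∧ IsStep D f Iᶜ := by
  classical
  obtain ⟨e, P, hP, hdis⟩ := h
  have heq : ∀ x x' u, u ∈ P x → u ∈ P x' → x = x' := fun x x' u h h' ↦ by
    by_contra hne
    exact hdis hne h h'
  have hstart : ∀ u ∈ X, ∀ x, u ∈ P x → (P x)[0]? = some u := by
    intro u hu x hux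
    have h1 := (hP ⟨u, hu⟩).2.2.1
    have h2 := heq x ⟨u, hu⟩ u hux (List.mem_of_mem_head? h1)
    rw [h2, ← List.head?_eq_getElem?]
    exact h1
  -- `f` moves a vertex to its successor on its path and fixes vertices off the paths. Only ends of
  -- paths lack a successor, and these lie in `I`; no successor lies in `X`, whose vertices begin
  -- their paths.
  have hnext : ∀ u, ∃ w, u ∉ I → (∃ x i, (P x)[i]? = some u ∧ (P x)[i + 1]? = some w) ∨
      (w = u ∧ ∀ x, u ∉ P x) := by
    intro u
    by_cases hu : ∃ x, u ∈ P x
    · obtain ⟨x, hx⟩ := hu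
      obtain ⟨i, hi, hiu⟩ := List.mem_iff_getElem.1 hx
      by_cases hi' : i + 1 < (P x).length
      · exact ⟨(P x)[i + 1], fun _ ↦ Or.inl ⟨x, i, by rw [List.getElem?_eq_getElem hi, hiu],
          List.getElem?_eq_getElem hi'⟩⟩
      · refine ⟨u, fun huI ↦ absurd ?_ huI⟩
        have h1 := (hP x).2.2.2
        rw [List.getLast?_eq_getElem?, show (P x).length - 1 = i by omega,
          List.getElem?_eq_getElem hi, hiu, Option.some_inj] at h1
        rw [h1]
        exact (e x).2
    · exact ⟨u, fun _ ↦ Or.inr ⟨rfl, fun x hx ↦ hu ⟨x, hx⟩⟩⟩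
  choose f hf using hnext
  refine ⟨f, fun u hu v hv huv ↦ ?_, fun u hu ↦ ?_, fun u hu ↦ ?_⟩
  · rcases hf u hu with ⟨x, i, h1, h2⟩ | ⟨h1, h2⟩ <;>
      rcases hf v hv with ⟨x', j, h3, h4⟩ | ⟨h3, h4⟩
    · rw [← huv] at h4
      obtain rfl := heq x x' _ (List.mem_of_getElem? h2) (List.mem_of_getElem? h4)
      have hi : i + 1 < (P x).length := (List.getElem?_eq_some_iff.1 h2).1
      have := (List.getElem?_inj hi (hP x).1).1 (h2.trans h4.symm)
      rw [Nat.add_right_cancel this, h3, Option.some_inj] at h1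
      exact h1.symm
    · rw [huv, h3] at h2
      exact absurd (List.mem_of_getElem? h2) (h4 x)
    · rw [← huv, h1] at h4
      exact absurd (List.mem_of_getElem? h4) (h2 x')
    · rw [← h1, ← h3, huv]
  · intro hX
    rcases hf u hu with ⟨x, i, h1, h2⟩ | ⟨h1, h2⟩
    · have h3 := hstart _ hX x (List.mem_of_getElem? h2)
      have hi : i + 1 < (P x).length := (List.getElem?_eq_some_iff.1 h2).1
      exact absurd ((List.getElem?_inj hi (hP x).1).1 (h2.trans h3.symm)) (Nat.succ_ne_zero i)
    · rw [h1] at hX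
      exact h2 ⟨u, hX⟩ (List.mem_of_mem_head? (hP ⟨u, hX⟩).2.2.1)
  · rcases hf u hu with ⟨x, i, h1, h2⟩ | ⟨h1, -⟩
    · right
      obtain ⟨hi, h3⟩ := List.getElem?_eq_some_iff.1 h2
      obtain ⟨_, h4⟩ := List.getElem?_eq_some_iff.1 h1
      have := List.isChain_iff_getElem.1 (hP x).2.1 i (by omega)
      rwa [h3, h4] at this
    · exact Or.inl h1

/-- An injection from the complement of `Y` into the complement of `X` along edges
yields a linking of `X` into `Y`. -/
theorem exists_isLinked_of_step [Finite V] {D : Digraph V} {X Y : Set V} {f : V → V}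
    (hinj : Set.InjOn f Yᶜ) (hmaps : Set.MapsTo f Yᶜ Xᶜ) (hstep : IsStep D f Yᶜ) :
    ∃ I ⊆ Y, IsLinked D X I := by
  classical
  -- Orbits started in `X` neither merge nor return before leaving `Yᶜ`: cancel `f` by injectivity
  -- until one side is in `X`, which `f` never reaches from `Yᶜ`. By finiteness each orbit therefore
  -- hits `Y`, and stopping there gives the paths.
  have hcancel : ∀ i j x x', x ∈ X → x' ∈ X → (∀ k < i, f^[k] x ∉ Y) → (∀ k < j, f^[k] x' ∉ Y) →
      f^[i] x = f^[j] x' → i = j ∧ x = x' := by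
    intro i
    induction i with
    | zero =>
      rintro (_ | j) x x' hx hx' - hj h
      · exact ⟨rfl, h⟩
      · rw [Function.iterate_succ_apply'] at h
        exact absurd (h ▸ (hx : f^[0] x ∈ X)) (hmaps (hj j j.lt_succ_self))
    | succ i ih =>
      rintro (_ | j) x x' hx hx' hi hj h
      · rw [Function.iterate_succ_apply'] at h
        exact absurd (h ▸ (hx' : f^[0] x' ∈ X)) (hmaps (hi i i.lt_succ_self))
      · rw [Function.iterate_succ_apply', Function.iterate_succ_apply'] at h
        have := ih j x x' hx hx' (fun k hk ↦ hi k (by omega)) (fun k hk ↦ hj k (by omega))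
          (hinj (hi i i.lt_succ_self) (hj j j.lt_succ_self) h)
        exact ⟨congrArg (· + 1) this.1, this.2⟩
  have hreach : ∀ x ∈ X, ∃ n, f^[n] x ∈ Y := by
    intro x hx
    by_contra! h
    obtain ⟨i, j, hij, h'⟩ := Finite.exists_ne_map_eq_of_infinite fun n ↦ f^[n] x
    exact hij (hcancel i j x x hx hx (fun k _ ↦ h k) (fun k _ ↦ h k) h').1
  have hlen : ∀ x, ∃ n, x ∈ X → f^[n] x ∈ Y ∧ ∀ k < n, f^[k] x ∉ Y := by
    intro x
    by_cases hx : x ∈ X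
    · exact ⟨Nat.find (hreach x hx), fun _ ↦ ⟨Nat.find_spec (hreach x hx),
        fun k hk ↦ Nat.find_min _ hk⟩⟩
    · exact ⟨0, fun h ↦ absurd h hx⟩
  choose n hn using hlen
  have hcancel' : ∀ x ∈ X, ∀ x' ∈ X, ∀ i ≤ n x, ∀ j ≤ n x', f^[i] x = f^[j] x' →
      i = j ∧ x = x' := fun x hx x' hx' i hi j hj h ↦
    hcancel i j x x' hx hx' (fun k hk ↦ (hn x hx).2 k (by omega))
      (fun k hk ↦ (hn x' hx').2 k (by omega)) h
  have hg : Set.InjOn (fun x ↦ f^[n x] x) X := fun x hx x' hx' h ↦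
    (hcancel' x hx x' hx' _ le_rfl _ le_rfl h).2
  refine ⟨(fun x ↦ f^[n x] x) '' X, ?_, hg.bijOn_image.equiv _,
    fun x ↦ (List.range (n x + 1)).map fun i ↦ f^[i] x, fun x ↦ ⟨?_, ?_, ?_, ?_⟩, ?_⟩
  · rintro _ ⟨x, hx, rfl⟩
    exact (hn x hx).1
  · refine List.Nodup.map_on (fun i hi j hj h ↦ ?_) List.nodup_range
    rw [List.mem_range] at hi hj
    exact (hcancel' x x.2 x x.2 i (by omega) j (by omega) h).1
  · rw [List.isChain_iff_getElem]
    intro i hi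
    simp only [List.length_map, List.length_range] at hi
    simp only [List.getElem_map, List.getElem_range]
    have h1 := hstep (f^[i] x) ((hn x x.2).2 i (by omega))
    rw [← Function.iterate_succ_apply' f] at h1
    refine h1.resolve_left fun h ↦ ?_
    have := (hcancel' x x.2 x x.2 (i + 1) (by omega) i (by omega) h).1
    omega
  · simp [List.head?_eq_getElem?]
  · rw [List.getLast?_eq_getElem?]
    simp only [List.length_map, List.length_range, Nat.add_sub_cancel, List.getElem?_map,
      List.getElem?_range (Nat.lt_succ_self _), Option.map_some]
    rfl
  · intro x x' hxx' u hu hu'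
    simp only [List.mem_map, List.mem_range] at hu hu'
    obtain ⟨i, hi, rfl⟩ := hu
    obtain ⟨j, hj, h⟩ := hu'
    exact hxx' (Subtype.ext (hcancel' x x.2 x' x'.2 i (by omega) j (by omega) h.symm).2)

/-! ### Matching along a relation and induction by directed graphs -/

/-- The matroid induced from `M` by a relation `R`: its independent sets are those which
can be matched along `R` to an independent set of `M`. -/
theorem IsStronglyBaseReorderable.exists_matching [Finite V] {M : Matroid V}
    (h : IsStronglyBaseReorderable M) (R : V → V → Prop) :
    ∃ N : Matroid V, N.E = Set.univ ∧ IsStronglyBaseReorderable N ∧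
      ∀ Z, N.Indep Z ↔ ∃ J, M.Indep J ∧ ∃ f : V → V, Set.BijOn f J Z ∧ ∀ u ∈ J, R u (f u) := by
  have hMf : M.Finite := ⟨Set.toFinite _⟩
  have hcf : (M.comap (Prod.fst : V × V → V)).Finite := ⟨Set.toFinite _⟩
  -- A matroid on edges: a set of edges of `R` is independent when their tails are distinct and
  -- independent in `M`. Taking heads gives the matched sets.
  set K := (M.comap (Prod.fst : V × V → V)).restrict {p | R p.1 p.2} with hK
  have hKf : K.Finite := ⟨Set.toFinite _⟩
  have hKr : IsStronglyBaseReorderable K := h.comap.restrict (Set.toFinite _)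
  obtain ⟨N, hNE, hN⟩ := exists_isImage (Prod.snd : V × V → V) K Set.finite_univ
    (Set.mapsTo_univ _ _)
  have hNf : N.Finite := ⟨Set.toFinite _⟩
  refine ⟨N, hNE, hKr.of_isImage hN, fun Z ↦ ⟨fun hZ ↦ ?_, ?_⟩⟩
  · obtain ⟨F, hF, hFZ⟩ := hN.exists_bijOn hZ
    rw [hK, Matroid.restrict_indep_iff, Matroid.comap_indep_iff] at hF
    obtain ⟨⟨hJ, hi⟩, hR⟩ := hF
    have hlift : ∀ u, ∃ v, u ∈ Prod.fst '' F → (u, v) ∈ F := by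
      intro u
      by_cases hu : u ∈ Prod.fst '' F
      · obtain ⟨p, hp, rfl⟩ := hu
        exact ⟨p.2, fun _ ↦ hp⟩
      · exact ⟨u, fun h ↦ absurd h hu⟩
    choose f hf using hlift
    refine ⟨_, hJ, f, ⟨fun u hu ↦ hFZ.mapsTo (hf u hu), fun u hu v hv huv ↦ ?_, fun z hz ↦ ?_⟩,
      fun u hu ↦ hR (hf u hu)⟩
    · exact congrArg Prod.fst (hFZ.injOn (hf u hu) (hf v hv) huv)
    · obtain ⟨p, hp, rfl⟩ := hFZ.surjOn hz
      have hp' : p.1 ∈ Prod.fst '' F := ⟨p, hp, rfl⟩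
      exact ⟨p.1, hp', congrArg Prod.snd (hi (hf _ hp') hp rfl)⟩
  · rintro ⟨J, hJ, f, hf, hR⟩
    refine (hN Z).2 ⟨(fun u ↦ (u, f u)) '' J, ?_, ?_⟩
    · rw [hK, Matroid.restrict_indep_iff, Matroid.comap_indep_iff, Set.image_image, Set.image_id']
      refine ⟨⟨hJ, ?_⟩, ?_⟩
      · rintro _ ⟨u, hu, rfl⟩ _ ⟨v, hv, rfl⟩ (rfl : u = v)
        rfl
      · rintro _ ⟨u, hu, rfl⟩
        exact hR u hu
    · rw [Set.image_image]
      exact hf.image_eq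

/-- A set is independent in the dual of `K` when it avoids some base of `K`, that is, a set matched
from a base of `L.dual`. By the correspondence between linkings and complementary injections, this
means being linked into a base of `L`. -/
theorem IsStronglyBaseReorderable.exists_isInducedBy [Finite V] {M : Matroid V}
    (h : IsStronglyBaseReorderable M) (D : Digraph V) (W : Set V) :
    ∃ N : Matroid V, IsInducedBy N M D W ∧ IsStronglyBaseReorderable N := by
  have hMf : M.Finite := ⟨Set.toFinite _⟩
  -- Vertices outside the ground set become loops, so that duality takes complements in all of `V`.
  set L := M.restrict Set.univ with hL
  have hLf : L.Finite := ⟨Set.toFinite _⟩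
  have hLi : ∀ I, L.Indep I ↔ M.Indep I := fun I ↦ by
    rw [hL, Matroid.restrict_indep_iff]
    exact and_iff_left (Set.subset_univ I)
  have hLr : IsStronglyBaseReorderable L := h.restrict (Set.toFinite _)
  have hcompl : ∀ B, L.E \ B = Bᶜ := fun B ↦ (Set.compl_eq_univ_sdiff B).symm
  obtain ⟨K, hKE, hKr, hK⟩ := hLr.dual.exists_matching fun u w ↦ w = u ∨ D.Adj u w
  have hKf : K.Finite := ⟨Set.toFinite _⟩
  have hself : ∀ J, L.dual.Indep J → K.Indep J := fun J hJ ↦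
    (hK J).2 ⟨J, hJ, id, Set.bijOn_id J, fun _ _ ↦ Or.inl rfl⟩
  refine ⟨K.dual.restrict W, ⟨rfl, fun X ↦ ?_⟩, hKr.dual.restrict (Set.toFinite _)⟩
  rw [Matroid.restrict_indep_iff, and_comm, Matroid.dual_indep_iff_exists (by simp [hKE])]
  refine and_congr_right fun _ ↦ ⟨?_, ?_⟩
  · rintro ⟨Z, hZ, hXZ⟩
    obtain ⟨J, hJ, f, hf, hfD⟩ := (hK Z).1 hZ.indep
    obtain ⟨J', hJ', hJJ'⟩ := hJ.exists_isBase_superset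
    obtain ⟨Z', hZ', hJZ'⟩ := (hself J' hJ'.indep).exists_isBase_superset
    -- The identity matching makes bases of `L.dual` independent in `K`, so `K` has at least the
    -- rank of `L.dual` and `J`, of the size of a base of `K`, is a base.
    have hJeq : J = J' := by
      refine Set.eq_of_subset_of_ncard_le hJJ' ?_ (Set.toFinite _)
      rw [← Set.InjOn.ncard_image hf.injOn, hf.image_eq, hZ.ncard_eq_ncard_of_isBase hZ']
      exact Set.ncard_le_ncard hJZ' (Set.toFinite _)
    subst hJeq
    obtain ⟨I, hI, hXI⟩ := exists_isLinked_of_step (D := D) (X := X) (Y := Jᶜ) (f := f)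
      (by rw [compl_compl]; exact hf.injOn)
      (by
        rw [compl_compl]
        exact fun u hu hX ↦ Set.disjoint_left.1 hXZ hX (hf.mapsTo hu))
      (by rw [compl_compl]; exact hfD)
    refine ⟨I, (hLi I).1 ?_, hXI⟩
    have hb := hJ'.compl_isBase_of_dual
    rw [hcompl] at hb
    exact hb.indep.subset hI
  · rintro ⟨I, hI, hXI⟩
    obtain ⟨f, hinj, hmaps, hstep⟩ := hXI.exists_step
    obtain ⟨B, hB, hIB⟩ := ((hLi I).2 hI).exists_isBase_superset
    have hBI : Bᶜ ⊆ Iᶜ := Set.compl_subset_compl.2 hIB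
    have hBd : L.dual.IsBase Bᶜ := by
      rw [← hcompl]
      exact hB.compl_isBase_dual
    have hZ : K.Indep (f '' Bᶜ) := (hK _).2 ⟨_, hBd.indep, f, (hinj.mono hBI).bijOn_image,
      fun u hu ↦ hstep u (hBI hu)⟩
    obtain ⟨Z, hZb, hZs⟩ := hZ.exists_isBase_superset
    refine ⟨Z, hZb, ?_⟩
    obtain ⟨J, hJ, g, hg, -⟩ := (hK Z).1 hZb.indep
    obtain ⟨J', hJ', hJJ'⟩ := hJ.exists_isBase_superset
    -- `f '' Bᶜ` is already a base of `K`: the base `Z` is matched from an independent set of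
    -- `L.dual`, hence is no larger than `Bᶜ`.
    rw [← Set.eq_of_subset_of_ncard_le hZs ?_ (Set.toFinite _), Set.disjoint_left]
    · rintro x hx ⟨u, hu, rfl⟩
      exact hmaps (hBI hu) hx
    · rw [Set.InjOn.ncard_image (hinj.mono hBI), ← hg.image_eq, Set.InjOn.ncard_image hg.injOn,
        hBd.ncard_eq_ncard_of_isBase hJ']
      exact Set.ncard_le_ncard hJJ' (Set.toFinite _)

end SBRO

theorem theorem2p2 :
    SBRO.IsCompleteClass.{u} (fun _ M ↦ SBRO.IsStronglyBaseReorderable M) where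
  isomorphism _ _ _ _ _ hf h := h.map hf
  minor _ _ _ _ hN h := h.isMinor hN
  dual _ _ _ h := h.dual
  directSum _ _ _ _ _ _ hM hN := hM.sum hN
  truncation _ _ _ k h := h.truncation k
  induction _ _ _ D W h := h.exists_isInducedBy D W
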